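/- Let $p$ be a prime, let $R$ be a non-zero commutative ring with identity, and let $\mathcal P$ be a finite poset without a smallest element. Assume that $\mathcal P$ is graded by $\dim\colon\mathcal P\to\mathbb N$, i.e. $x<y$ implies $\dim x<\dim y$, $\dim y=\dim x+1$ whenever $y$ covers $x$, and $\dim$ vanishes on the minimal elements. Assume that $\mathcal P$ is locally $p$-Quillen: for every $x\in\mathcal P$ the poset $\mathcal P_{\le x}=\{y\in\mathcal P : y\le x\}$ is isomorphic to $\mathcal A_p\bigl(C_p^{\dim x+1}\bigr)$, where $C_p$ is the cyclic group of order $p$ and $\mathcal A_p(G)$ denotes the poset of non-trivial elementary abelian $p$-subgroups of a group $G$, ordered by inclusion. Suppose that $\dim\mathcal P=\max_{x\in\mathcal P}\dim x=N$ and that the reduced simplicial homology $\widetilde H_N(|\mathcal P|;R)$ of the order complex of $\mathcal P$ is zero. Call an object of $\mathcal P$ free if it is non-maximal and is smaller than a unique maximal object. Then the set of non-maximal objects of $\mathcal P$ of dimension $N-1$ is non-empty, and the proportion $r$ of free objects in this set satisfies $$r\ \ge\ \frac{p^{N+1}-2p^N+1}{p^{N+1}-p^N}\ >\ 0 .$$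 -/

import Mathlib

/-! ### The poset of non-trivial elementary abelian `p`-subgroups -/

/-- A subgroup is elementary abelian of exponent `p`: it is commutative and every element
is killed by `p` (the trivial subgroup is included here). -/
def IsElemAbelian (p : ℕ) {G : Type*} [Group G] (H : Subgroup G) : Prop :=
  (∀ a ∈ H, ∀ b ∈ H, a * b = b * a) ∧ ∀ a ∈ H, a ^ p = 1

/-- Quillen's poset `𝒜_p(G)`: the non-trivial elementary abelian `p`-subgroups of `G`,
ordered by inclusion. -/
abbrev QuillenPoset (p : ℕ) (G : Type*) [Group G] : Type _ :=
  {H : Subgroup G // H ≠ ⊥ ∧ IsElemAbelian p H}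

/-- A graded poset is locally `p`-Quillen if every principal lower set `P_{≤ x}` is isomorphic, as
a poset, to `𝒜_p(C_p ^ (dim x + 1))`. Gradings take values in `ℕ`, are strictly monotone,
raise by one along covering relations, and vanish on minimal elements. -/
def IsLocallyQuillen (p : ℕ) (P : Type*) [PartialOrder P] [GradeMinOrder ℕ P] : Prop :=
  ∀ x : P, Nonempty (Set.Iic x ≃o
    QuillenPoset p (Fin (grade ℕ x + 1) → Multiplicative (ZMod p)))

/-- `dim P = N`: the maximum of the dimensions of the elements of `P` exists and equals `N`. -/
def HasDim (P : Type*) [PartialOrder P] [GradeMinOrder ℕ P] (N : ℕ) : Prop :=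
  IsGreatest (Set.range (fun x : P => grade ℕ x)) N

/-! ### Reduced simplicial homology of the order complex -/

/-- The reduced simplicial chains of the order complex of `P`, indexed by the number of
vertices: `OrderChains R P k` is free on the chains `x₀ < ⋯ < x_{k-1}`, so it is the module of
reduced chains of degree `k - 1`. For `k = 0` it is free on the empty chain, that is, it is `R`. -/
def OrderChains (R : Type*) [CommRing R] (P : Type*) [PartialOrder P] (k : ℕ) : Type _ :=
  (Fin k ↪o P) →₀ R

noncomputable instance OrderChains.instAddCommGroup (R : Type*) [CommRing R] (P : Type*)
    [PartialOrder P] (k : ℕ) : AddCommGroup (OrderChains R P k) :=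
  inferInstanceAs (AddCommGroup ((Fin k ↪o P) →₀ R))

noncomputable instance OrderChains.instModule (R : Type*) [CommRing R] (P : Type*)
    [PartialOrder P] (k : ℕ) : Module R (OrderChains R P k) :=
  inferInstanceAs (Module R ((Fin k ↪o P) →₀ R))

/-- The `i`-th face map, `x₀ < ⋯ < x_k ↦ x₀ < ⋯ < x_{i-1} < x_{i+1} < ⋯ < x_k`. -/
noncomputable def orderFace (R : Type*) [CommRing R] (P : Type*) [PartialOrder P] (k : ℕ)
    (i : Fin (k + 1)) : OrderChains R P (k + 1) →ₗ[R] OrderChains R P k :=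
  Finsupp.lmapDomain R R (fun c : Fin (k + 1) ↪o P => (Fin.succAboveOrderEmb i).trans c)

/-- The simplicial differential `∑ᵢ (-1)ⁱ ∂ᵢ`, where `∂ᵢ` deletes the `i`-th vertex of a chain.
For `k = 0` this is the augmentation. -/
noncomputable def orderBoundary (R : Type*) [CommRing R] (P : Type*) [PartialOrder P] (k : ℕ) :
    OrderChains R P (k + 1) →ₗ[R] OrderChains R P k :=
  ∑ i : Fin (k + 1), (-1 : R) ^ (i : ℕ) • orderFace R P k i

/-- The simplicial identity for the face maps. -/
theorem orderFace_comp (R : Type*) [CommRing R] (P : Type*) [PartialOrder P] (k : ℕ)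
    (i i' : Fin (k + 1)) (j j' : Fin (k + 2)) (hij : (j : ℕ) ≤ i)
    (hi' : (i' : ℕ) = j) (hj' : (j' : ℕ) = i + 1) :
    orderFace R P k i ∘ₗ orderFace R P (k + 1) j =
      orderFace R P k i' ∘ₗ orderFace R P (k + 1) j' := by
  refine (Finsupp.lmapDomain_comp R R _ _).symm.trans
    (Eq.trans ?_ (Finsupp.lmapDomain_comp R R _ _))
  congr 1
  funext c
  ext a
  simp only [Function.comp_apply, RelEmbedding.coe_trans, Fin.succAboveOrderEmb_apply]
  congr 1
  simp only [Fin.ext_iff, Fin.succAbove, Fin.lt_def, apply_ite Fin.val, Fin.val_castSucc,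
    Fin.val_succ, hi', hj']
  split_ifs <;> omega

/-- The differential squares to zero. -/
theorem orderBoundary_comp (R : Type*) [CommRing R] (P : Type*) [PartialOrder P] (k : ℕ) :
    orderBoundary R P k ∘ₗ orderBoundary R P (k + 1) = 0 := by
  have expand : orderBoundary R P k ∘ₗ orderBoundary R P (k + 1) =
      ∑ ij : Fin (k + 1) × Fin (k + 2), ((-1 : R) ^ (ij.1 : ℕ) * (-1 : R) ^ (ij.2 : ℕ)) •
        (orderFace R P k ij.1 ∘ₗ orderFace R P (k + 1) ij.2) := by
    simp only [← Finset.univ_product_univ, Finset.sum_product]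
    ext1 c
    simp only [orderBoundary, LinearMap.comp_apply, LinearMap.sum_apply, LinearMap.smul_apply,
      map_sum, map_smul, Finset.smul_sum, smul_smul]
    rw [Finset.sum_comm]
    simp only [mul_comm]
  rw [expand]
  let Q := Fin (k + 1) × Fin (k + 2)
  let S : Finset Q := {ij : Q | (ij.2 : ℕ) ≤ (ij.1 : ℕ)}
  rw [← Finset.sum_add_sum_compl S, ← eq_neg_iff_add_eq_zero,
    ← Finset.sum_neg_distrib]
  let φ : ∀ ij : Q, ij ∈ S → Q := fun ij hij =>
    (Fin.castLT ij.2 (lt_of_le_of_lt (Finset.mem_filter.mp hij).right (Fin.is_lt ij.1)), ij.1.succ)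
  apply Finset.sum_bij φ
  · intro ij hij
    simp_rw [S, φ, Finset.compl_filter, Finset.mem_filter_univ, Fin.val_succ,
      Fin.val_castLT] at hij ⊢
    lia
  · rintro ⟨i, j⟩ hij ⟨i', j'⟩ hij' h
    have h1 := congrArg (fun q : Q => (q.1 : ℕ)) h
    have h2 := congrArg (fun q : Q => (q.2 : ℕ)) h
    simp only [φ, Fin.val_castLT, Fin.val_succ] at h1 h2
    exact Prod.ext (Fin.ext (by simpa using h2)) (Fin.ext h1)
  · rintro ⟨i', j'⟩ hij'
    simp_rw [S, Finset.compl_filter, Finset.mem_filter_univ, not_le] at hij'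
    refine ⟨(j'.pred <| ?_, Fin.castSucc i'), ?_, ?_⟩
    · rintro rfl
      simp at hij'
    · simp only [S, Finset.mem_filter_univ, Fin.val_castSucc, Fin.val_pred]
      omega
    · simp only [φ, Fin.castLT_castSucc, Fin.succ_pred]
  · rintro ⟨i, j⟩ hij
    simp only [S, Finset.mem_filter_univ] at hij
    rw [← neg_smul]
    congr 1
    · simp only [φ, Fin.val_succ, Fin.val_castLT]
      ring
    · exact orderFace_comp R P k _ _ _ _ hij rfl rfl

/-- The reduced cycles of degree `n`, as a submodule of the chains with `n + 1` vertices. -/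
noncomputable abbrev orderCycles (R : Type*) [CommRing R] (P : Type*) [PartialOrder P] (n : ℕ) :
    Submodule R (OrderChains R P (n + 1)) :=
  LinearMap.ker (orderBoundary R P n)

/-- The boundaries of degree `n`, as a submodule of the cycles of degree `n`. -/
noncomputable abbrev orderBoundaries (R : Type*) [CommRing R] (P : Type*) [PartialOrder P]
    (n : ℕ) : Submodule R (orderCycles R P n) :=
  (LinearMap.range (orderBoundary R P (n + 1))).submoduleOf (orderCycles R P n)

/-- The reduced homology `H̃_n(|P|; R)` for `n ≥ 0`: cycles of degree `n` modulo boundaries. -/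
abbrev ReducedHomology (R : Type*) [CommRing R] (P : Type*) [PartialOrder P] (n : ℕ) : Type _ :=
  orderCycles R P n ⧸ orderBoundaries R P n

/-! ### Free objects -/

/-- A free object: a non-maximal object which is smaller than a unique maximal object. -/
def IsFreeObject {P : Type*} [PartialOrder P] (x : P) : Prop :=
  ¬ IsMax x ∧ ∃! m : P, IsMax m ∧ x < m

/-- The non-maximal objects of `P_{N-1}`, that is, those of dimension `N - 1`
(there are none if `N = 0`). -/
def nonMaximalCodimOne (P : Type*) [PartialOrder P] [GradeMinOrder ℕ P] (N : ℕ) : Set P :=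
  {x | grade ℕ x + 1 = N ∧ ¬ IsMax x}

/-- The free objects among the objects of dimension `N - 1`. -/
def freeCodimOne (P : Type*) [PartialOrder P] [GradeMinOrder ℕ P] (N : ℕ) : Set P :=
  {x | x ∈ nonMaximalCodimOne P N ∧ IsFreeObject x}

/-- The proportion of free objects among the non-maximal objects of dimension `N - 1`. -/
noncomputable def freeProportion (P : Type*) [PartialOrder P] [GradeMinOrder ℕ P] (N : ℕ) : ℝ :=
  ((freeCodimOne P N).ncard : ℝ) / ((nonMaximalCodimOne P N).ncard : ℝ)

/-! Adjoin a bottom to `P`. The elements below an object of dimension `d` then form the lattice of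
subspaces of `𝔽_p ^ (d + 1)`. The top reduced cycles of the proper part of the subspace lattice of
`𝔽_p ^ n` form a free `R`-module of rank `p ^ (n choose 2)` (the Steinberg module): fix an atom `a`
and restrict to the `p ^ (n - 1)` hyperplanes avoiding `a`; this restriction is bijective
(`flagCyclesRestrict_bijective`), so induction applies.

There are no chains with `N + 2` elements, so vanishing of the homology in degree `N` means that
there are no non-zero `N`-cycles. Hence the map from the sum of the Steinberg modules of the `A`
objects of dimension `N` to that of the `m` elements they cover is injective, since a kernel element
would be an `N`-cycle. Comparing ranks gives `A * p ^ N ≤ m` (`card_mul_pow_le`).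

Each top object covers at most `(p ^ (N + 1) - 1) / (p - 1)` objects, and each non-free object of
dimension `N - 1` below a top object lies below at least two of them. Counting covering pairs
(`two_mul_card_le`) bounds `2 * m - f`, with `f` the number of free objects, and eliminating `A`
gives the claim. -/

/-! ### Hyperplanes of a finite vector space -/

section Hyperplanes

variable {K V : Type*} [Field K] [AddCommGroup V] [Module K V] [FiniteDimensional K V]

theorem Submodule.finrank_of_covBy_top {H : Submodule K V} (h : H ⋖ ⊤) :
    Module.finrank K H + 1 = Module.finrank K V := by
  have h1 : IsSimpleModule K (V ⧸ H) := isSimpleModule_iff_isCoatom.2 (covBy_top_iff.1 h)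
  rw [isSimpleModule_iff_finrank_eq_one] at h1
  have := H.finrank_quotient_add_finrank
  omega

theorem LinearMap.ker_covBy_top {φ : Module.Dual K V} (h : φ ≠ 0) : LinearMap.ker φ ⋖ ⊤ := by
  rw [covBy_top_iff, ← isSimpleModule_iff_isCoatom, isSimpleModule_iff_finrank_eq_one]
  have h1 := Module.Dual.finrank_ker_add_one_of_ne_zero h
  have := (LinearMap.ker φ).finrank_quotient_add_finrank
  omega

/-- Linear functionals with value `1` at `v` correspond to hyperplanes avoiding `v`. -/
theorem card_covBy_top_notMem [Finite K] {v : V} (hv : v ≠ 0) {n : ℕ}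
    (hn : Module.finrank K V = n + 1) :
    Nat.card {H : Submodule K V // H ⋖ ⊤ ∧ v ∉ H} = Nat.card K ^ n := by
  obtain ⟨ψ, hψ⟩ := Module.Projective.exists_dual_eq_one K hv
  let ev : Module.Dual K (Module.Dual K V) := Module.Dual.eval K V v
  have hev : ev ≠ 0 := fun h => one_ne_zero (hψ.symm.trans (LinearMap.congr_fun h ψ))
  -- These functionals are a translate by `ψ` of the annihilator of `v`, which has dimension `n`.
  have e1 : {φ : Module.Dual K V // φ v = 1} ≃ LinearMap.ker ev :=
    (Equiv.subRight ψ).subtypeEquiv fun φ => by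
      simp [ev, Module.Dual.eval_apply, hψ, sub_eq_zero]
  have hcard : Nat.card {φ : Module.Dual K V // φ v = 1} = Nat.card K ^ n := by
    have h1 := Module.Dual.finrank_ker_add_one_of_ne_zero hev
    rw [Subspace.dual_finrank_eq, hn] at h1
    rw [Nat.card_congr e1, Module.natCard_eq_pow_finrank (K := K), Nat.succ_injective h1]
  rw [← hcard]
  refine (Nat.card_congr (Equiv.ofBijective (fun φ : {φ : Module.Dual K V // φ v = 1} =>
    (⟨LinearMap.ker φ.1, LinearMap.ker_covBy_top ?_, ?_⟩ :
      {H : Submodule K V // H ⋖ ⊤ ∧ v ∉ H})) ⟨?_, ?_⟩)).symm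
  · intro h
    exact one_ne_zero (φ.2.symm.trans (LinearMap.congr_fun h v))
  · simp [φ.2]
  · rintro ⟨φ, hφ⟩ ⟨χ, hχ⟩ h
    have h' : LinearMap.ker φ = LinearMap.ker χ := congrArg Subtype.val h
    refine Subtype.ext (LinearMap.ext fun w => ?_)
    -- Modulo the common kernel, `w` is `φ w • v`, and `χ v = 1`.
    have hw : w - φ w • v ∈ LinearMap.ker φ := by simp [hφ]
    rw [h', LinearMap.mem_ker, map_sub, map_smul, hχ, smul_eq_mul, mul_one, sub_eq_zero] at hw
    exact hw.symm
  · rintro ⟨H, hH, hvH⟩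
    obtain ⟨φ, hφ, hmap⟩ := Submodule.exists_dual_map_eq_bot_of_notMem hvH inferInstance
    refine ⟨⟨(φ v)⁻¹ • φ, by simp [hφ]⟩, Subtype.ext ?_⟩
    have h1 : H ≤ LinearMap.ker ((φ v)⁻¹ • φ) := by
      intro w hw
      have : φ w ∈ H.map φ := Submodule.mem_map_of_mem hw
      rw [hmap, Submodule.mem_bot] at this
      simp [this]
    refine ((hH.eq_or_eq h1 le_top).resolve_right fun h => ?_)
    have : v ∈ LinearMap.ker ((φ v)⁻¹ • φ) := h ▸ Submodule.mem_top
    simp [hφ] at this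

/-- Annihilators turn hyperplanes into lines of the dual space, that is, into points of a projective
space. The factor `Nat.card K - 1` avoids a division. -/
theorem card_covBy_top [Finite K] {n : ℕ} (hn : Module.finrank K V = n) :
    Nat.card {H : Submodule K V // H ⋖ ⊤} * (Nat.card K - 1) = Nat.card K ^ n - 1 := by
  have key (S : Submodule K (Module.Dual K V)) : Module.finrank K S = 1 ↔ ⊥ ⋖ S := by
    rw [bot_covBy_iff, ← isSimpleModule_iff_isAtom]
    exact (isSimpleModule_iff_finrank_eq_one (R := K) (M := S)).symm
  let d := Subspace.orderIsoFiniteDimensional (K := K) (V := V)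
  have e1 : {H : Submodule K V // H ⋖ ⊤} ≃
      {H : Submodule K (Module.Dual K V) // Module.finrank K H = 1} :=
    (d.toEquiv.trans OrderDual.ofDual).subtypeEquiv fun H => by
      rw [key, ← apply_covBy_apply_iff d, map_top, ← ofDual_covBy_ofDual_iff]
      rfl
  rw [Nat.card_congr (e1.trans (Projectivization.equivSubmodule _ _).symm), ← Projectivization.card,
    Module.natCard_eq_pow_finrank (K := K), Subspace.dual_finrank_eq, hn]

end Hyperplanes

/-! ### Elements whose principal lower set is a subspace lattice -/

/-- The principal lower set of `x` is isomorphic to the lattice of subspaces of `𝔽_p ^ n`. -/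
def HasSubspaceRank (p n : ℕ) {Q : Type*} [PartialOrder Q] (x : Q) : Prop :=
  Nonempty (Set.Iic x ≃o Submodule (ZMod p) (Fin n → ZMod p))

theorem Set.Iic.coe_covBy_coe_iff {Q : Type*} [PartialOrder Q] {x : Q} {a b : Set.Iic x} :
    (a : Q) ⋖ b ↔ a ⋖ b :=
  Set.OrdConnected.apply_covBy_apply_iff (OrderEmbedding.subtype fun c => c ≤ x)
    (by
      rw [OrderEmbedding.coe_subtype, Subtype.range_coe_subtype]
      exact Set.ordConnected_Iic)

namespace HasSubspaceRank

variable {p n : ℕ} {Q : Type*} [PartialOrder Q] {x y : Q}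

theorem eq_of_le (h : HasSubspaceRank p 0 x) (hy : y ≤ x) : y = x := by
  obtain ⟨e⟩ := h
  exact congrArg Subtype.val (e.injective (Subsingleton.elim (e ⟨y, hy⟩) (e ⟨x, le_rfl⟩)))

theorem map_top (e : Set.Iic x ≃o Submodule (ZMod p) (Fin n → ZMod p)) :
    e ⟨x, le_rfl⟩ = ⊤ := by
  have : (⟨x, le_rfl⟩ : Set.Iic x) = ⊤ := rfl
  rw [this, OrderIso.map_top]

theorem covBy_iff_apply_covBy_top (e : Set.Iic x ≃o Submodule (ZMod p) (Fin n → ZMod p))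
    (hy : y ≤ x) : y ⋖ x ↔ e ⟨y, hy⟩ ⋖ ⊤ := by
  rw [← map_top e, apply_covBy_apply_iff, ← Set.Iic.coe_covBy_coe_iff]

/-- An element covered by `x` corresponds to a hyperplane, and its lower set to the subspaces of
that hyperplane. All inductions on rank rest on this. -/
theorem of_covBy [Fact p.Prime] (h : HasSubspaceRank p (n + 1) x) (hy : y ⋖ x) :
    HasSubspaceRank p n y := by
  obtain ⟨e⟩ := h
  set S := e ⟨y, hy.le⟩ with hS
  have hr := Submodule.finrank_of_covBy_top ((covBy_iff_apply_covBy_top e hy.le).1 hy)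
  rw [Module.finrank_fin_fun, ← hS] at hr
  have f : S ≃ₗ[ZMod p] (Fin n → ZMod p) :=
    LinearEquiv.ofFinrankEq _ _ (by rw [Module.finrank_fin_fun]; omega)
  have g : Set.Iic y ≃o Set.Iic S :=
    { toFun := fun a => ⟨e ⟨a, a.2.trans hy.le⟩, e.monotone a.2⟩
      invFun := fun T => ⟨e.symm T, by
        have : e.symm T ≤ ⟨y, hy.le⟩ := by rw [OrderIso.symm_apply_le]; exact T.2
        exact this⟩
      left_inv := fun a => by simp
      right_inv := fun T => Subtype.ext (e.apply_symm_apply T)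
      map_rel_iff' := by
        intro a b
        exact e.le_iff_le }
  exact ⟨g.trans ((Submodule.mapIic S).symm.trans (Submodule.orderIsoMapComap f))⟩

theorem map_bot [OrderBot Q] (e : Set.Iic x ≃o Submodule (ZMod p) (Fin n → ZMod p)) :
    e ⟨⊥, bot_le⟩ = ⊥ := by
  have : (⟨⊥, bot_le⟩ : Set.Iic x) = ⊥ := rfl
  rw [this, OrderIso.map_bot]

theorem isAtom_iff_apply [OrderBot Q] (e : Set.Iic x ≃o Submodule (ZMod p) (Fin n → ZMod p))
    (hy : y ≤ x) : IsAtom y ↔ IsAtom (e ⟨y, hy⟩) := by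
  rw [← bot_covBy_iff, ← bot_covBy_iff, ← map_bot e, apply_covBy_apply_iff,
    ← Set.Iic.coe_covBy_coe_iff]

theorem exists_isAtom_le [OrderBot Q] [Fact p.Prime] (h : HasSubspaceRank p (n + 1) x) :
    ∃ a, IsAtom a ∧ a ≤ x := by
  obtain ⟨e⟩ := h
  obtain ⟨S, hS⟩ := IsAtomic.exists_atom (Submodule (ZMod p) (Fin (n + 1) → ZMod p))
  refine ⟨e.symm S, (isAtom_iff_apply e (e.symm S).2).2 ?_, (e.symm S).2⟩
  simpa using hS

/-- In a subspace lattice, an element `u` not above an atom `a` has a unique cover above `a`,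
and this cover has codimension one if some cover of `u` does. -/
theorem exists_covBy_of_not_le [OrderBot Q] [Fact p.Prime] (h : HasSubspaceRank p n x) {a u : Q}
    (ha : IsAtom a) (hax : a ≤ x) (hux : u ≤ x) (hau : ¬ a ≤ u) :
    ∃ w, u ⋖ w ∧ a ≤ w ∧ (∀ w', u ⋖ w' → a ≤ w' → w' ≤ x → w' = w) ∧
      ∀ y, u ⋖ y → y ⋖ x → w ⋖ x := by
  obtain ⟨e⟩ := h
  have hle : ∀ {b c : Q} (hb : b ≤ x) (hc : c ≤ x), b ≤ c ↔ e ⟨b, hb⟩ ≤ e ⟨c, hc⟩ := by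
    intro b c hb hc
    rw [OrderIso.le_iff_le]; rfl
  have hcov : ∀ {b c : Q} (hb : b ≤ x) (hc : c ≤ x), b ⋖ c ↔ e ⟨b, hb⟩ ⋖ e ⟨c, hc⟩ := by
    intro b c hb hc
    rw [apply_covBy_apply_iff, ← Set.Iic.coe_covBy_coe_iff]
  set A := e ⟨a, hax⟩ with hA
  set U := e ⟨u, hux⟩ with hU
  have hA' : IsAtom A := (isAtom_iff_apply e hax).1 ha
  have hAU : ¬ A ≤ U := by rwa [← hle]
  have hinf : A ⊓ U = ⊥ := (hA'.not_le_iff_disjoint.1 hAU).eq_bot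
  -- The required cover is `A ⊔ U`, by modularity.
  have hUW : U ⋖ A ⊔ U := covBy_sup_of_inf_covBy_left (by rw [hinf]; exact hA'.bot_covBy)
  have hw : e ⟨(e.symm (A ⊔ U) : Q), (e.symm (A ⊔ U)).2⟩ = A ⊔ U := by simp
  refine ⟨(e.symm (A ⊔ U) : Q), ?_, ?_, ?_, ?_⟩
  · rw [hcov hux (e.symm (A ⊔ U)).2, hw]; exact hUW
  · rw [hle hax (e.symm (A ⊔ U)).2, hw]; exact le_sup_left
  · intro w' h1 h2 h3
    rw [hcov hux h3] at h1
    rw [hle hax h3] at h2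
    have h4 : A ⊔ U ≤ e ⟨w', h3⟩ := sup_le h2 h1.le
    have h5 : A ⊔ U = e ⟨w', h3⟩ := (h4.lt_or_eq).resolve_left fun h => h1.2 hUW.lt h
    simp [h5]
  · intro y h1 h2
    rw [hcov hux h2.le] at h1
    rw [covBy_iff_apply_covBy_top e (e.symm (A ⊔ U)).2, hw]
    have h2' := (covBy_iff_apply_covBy_top e h2.le).1 h2
    set Y := e ⟨y, h2.le⟩
    by_cases hAY : A ≤ Y
    · have h4 : A ⊔ U ≤ Y := sup_le hAY h1.le
      rwa [(h4.lt_or_eq).resolve_left fun h => h1.2 hUW.lt h]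
    -- `Y` and `A ⊔ U` have join `⊤` and meet `U`, so modularity turns `U ⋖ Y` into `A ⊔ U ⋖ ⊤`.
    · have h5 : Y ⊔ (A ⊔ U) = ⊤ := by
        refine (h2'.eq_or_eq le_sup_left le_top).resolve_left fun h => hAY ?_
        rw [← h]; exact le_sup_left.trans le_sup_right
      have h6 : Y ⊓ (A ⊔ U) = U := by
        refine (hUW.eq_or_eq (le_inf h1.le hUW.le) inf_le_right).resolve_right fun h => hAY ?_
        exact le_sup_left.trans (inf_eq_right.1 h)
      rw [← h5]
      exact covBy_sup_of_inf_covBy_left (by rwa [h6])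

/-- The coatoms below `x` correspond to hyperplanes. -/
def covByEquiv (e : Set.Iic x ≃o Submodule (ZMod p) (Fin n → ZMod p)) :
    {y : Q // y ⋖ x} ≃ {H : Submodule (ZMod p) (Fin n → ZMod p) // H ⋖ ⊤} where
  toFun y := ⟨e ⟨y, y.2.le⟩, (covBy_iff_apply_covBy_top e y.2.le).1 y.2⟩
  invFun H := ⟨e.symm H, (covBy_iff_apply_covBy_top e (e.symm H).2).2 (by simpa using H.2)⟩
  left_inv y := by simp
  right_inv H := Subtype.ext (e.apply_symm_apply H)

theorem card_covBy [Fact p.Prime] (h : HasSubspaceRank p n x) :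
    Nat.card {y : Q // y ⋖ x} * (p - 1) = p ^ n - 1 := by
  obtain ⟨e⟩ := h
  rw [Nat.card_congr (covByEquiv e)]
  have := card_covBy_top (K := ZMod p) (V := Fin n → ZMod p) (n := n) (by simp)
  rwa [Nat.card_zmod] at this

/-- The atom is a line spanned by some `v`, so this counts the hyperplanes that miss `v`. -/
theorem card_covBy_not_le [OrderBot Q] [Fact p.Prime] (h : HasSubspaceRank p (n + 1) x) {a : Q}
    (ha : IsAtom a) (hax : a ≤ x) : Nat.card {y : Q // y ⋖ x ∧ ¬ a ≤ y} = p ^ n := by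
  obtain ⟨e⟩ := h
  have hA : IsAtom (e ⟨a, hax⟩) := (isAtom_iff_apply e hax).1 ha
  obtain ⟨v, hvA, hv⟩ := Submodule.exists_mem_ne_zero_of_ne_bot hA.1
  have hspan : e ⟨a, hax⟩ = Submodule.span (ZMod p) {v} :=
    ((hA.le_iff.1 ((Submodule.span_singleton_le_iff_mem _ _).2 hvA)).resolve_left
      (by simpa using hv)).symm
  have := card_covBy_top_notMem (K := ZMod p) hv (n := n) (by simp)
  rw [Nat.card_zmod] at this
  rw [← this]
  refine Nat.card_congr ?_
  refine (Equiv.subtypeSubtypeEquivSubtypeInter _ _).symm.trans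
    (((covByEquiv e).subtypeEquiv ?_).trans (Equiv.subtypeSubtypeEquivSubtypeInter
      (fun H : Submodule (ZMod p) (Fin (n + 1) → ZMod p) => H ⋖ ⊤) (fun H => v ∉ H)))
  intro y
  refine not_congr ?_
  have : a ≤ (y : Q) ↔ e ⟨a, hax⟩ ≤ e ⟨y, y.2.le⟩ := by rw [OrderIso.le_iff_le]; rfl
  rw [this, hspan, Submodule.span_singleton_le_iff_mem]
  rfl

end HasSubspaceRank

/-! ### Top-dimensional cycles on descending flags -/

section FlagCycles

variable (R : Type*) [CommRing R] {Q : Type*} [PartialOrder Q] [Fintype Q]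

open Classical in
/-- The top-dimensional reduced cycles of the order complex of `{y | ⊥ < y < x}`, for `x` of rank
`n`, as functions supported on the lists `[y_{n-1}, …, y_0]` with `x ⋗ y_{n-1} ⋗ ⋯ ⋗ y_0`. -/
noncomputable def flagCycles : ℕ → Q → Submodule R (List Q → R)
  | 0, _ => ⨅ (y : Q) (l : List Q), LinearMap.ker (LinearMap.proj (y :: l))
  -- For `x` of rank `n + 1` the supporting lists end in the bottom element, so the augmentation
  -- condition is the case of the last clause where `w` is the bottom. Cycle conditions at lower
  -- positions come from the recursive clause.
  | n + 1, x => LinearMap.ker (LinearMap.proj []) ⊓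
      (⨅ y : Q, (if y ⋖ x then flagCycles n y else ⊥).comap
        (LinearMap.funLeft R R (fun l : List Q => y :: l))) ⊓
      ⨅ (w : Q) (l : List Q), LinearMap.ker (∑ y : Q, LinearMap.proj (y :: w :: l))

variable {R}

theorem mem_flagCycles_zero {x : Q} {f : List Q → R} :
    f ∈ flagCycles R 0 x ↔ ∀ y l, f (y :: l) = 0 := by
  simp [flagCycles, Submodule.mem_iInf]

theorem mem_flagCycles_succ {n : ℕ} {x : Q} {f : List Q → R} :
    f ∈ flagCycles R (n + 1) x ↔ f [] = 0 ∧
      (∀ y, y ⋖ x → (fun l => f (y :: l)) ∈ flagCycles R n y) ∧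
      (∀ y, ¬ y ⋖ x → ∀ l, f (y :: l) = 0) ∧ ∀ w l, ∑ y, f (y :: w :: l) = 0 := by
  simp only [flagCycles, Submodule.mem_inf, Submodule.mem_iInf, LinearMap.mem_ker,
    LinearMap.proj_apply, Submodule.mem_comap, LinearMap.sum_apply, and_assoc]
  refine and_congr_right fun _ => ?_
  rw [← and_assoc]
  refine and_congr_left fun _ => ⟨fun h => ⟨fun y hy => ?_, fun y hy l => ?_⟩, fun h y => ?_⟩
  · have := h y
    rwa [if_pos hy] at this
  · have := h y
    simp only [hy, if_false, Submodule.mem_bot] at this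
    exact congrFun this l
  · split_ifs with hy
    · exact h.1 y hy
    · exact funext (h.2 y hy)

/-- The coefficients of a flag cycle satisfy the cycle condition at every position. -/
theorem sum_insert_eq_zero_of_mem_flagCycles {w : Q} {l₂ : List Q} :
    ∀ {n : ℕ} {x : Q} {f : List Q → R} (_ : f ∈ flagCycles R n x) (l₁ : List Q),
      ∑ y, f (l₁ ++ y :: w :: l₂) = 0
  | 0, _, f, hf, l₁ => by
    rw [mem_flagCycles_zero] at hf
    refine Finset.sum_eq_zero fun y _ => ?_
    cases l₁ <;> exact hf _ _
  | n + 1, x, f, hf, [] => (mem_flagCycles_succ.1 hf).2.2.2 w l₂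
  | n + 1, x, f, hf, z :: l₁ => by
    rw [mem_flagCycles_succ] at hf
    by_cases hz : z ⋖ x
    · exact sum_insert_eq_zero_of_mem_flagCycles (hf.2.1 z hz) l₁
    · exact Finset.sum_eq_zero fun y _ => hf.2.2.1 z hz _

/-- Flag cycles are supported on descending flags of the right length. -/
theorem isChain_of_mem_flagCycles :
    ∀ {n : ℕ} {x : Q} {f : List Q → R} (_ : f ∈ flagCycles R n x) {l : List Q} (_ : f l ≠ 0),
      (x :: l).IsChain (fun a b => b ⋖ a)
  | 0, _, f, hf, [], _ => by simp
  | 0, _, f, hf, y :: l, h => (h (mem_flagCycles_zero.1 hf y l)).elim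
  | n + 1, x, f, hf, [], h => (h (mem_flagCycles_succ.1 hf).1).elim
  | n + 1, x, f, hf, y :: l, h => by
    rw [mem_flagCycles_succ] at hf
    have hy : y ⋖ x := by
      by_contra hy
      exact h (hf.2.2.1 y hy l)
    exact List.isChain_cons_cons.2 ⟨hy, isChain_of_mem_flagCycles (hf.2.1 y hy) h⟩

theorem length_of_mem_flagCycles :
    ∀ {n : ℕ} {x : Q} {f : List Q → R} (_ : f ∈ flagCycles R n x) {l : List Q} (_ : f l ≠ 0),
      l.length = n
  | 0, _, f, hf, [], _ => by simp
  | 0, _, f, hf, y :: l, h => (h (mem_flagCycles_zero.1 hf y l)).elim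
  | n + 1, x, f, hf, [], h => (h (mem_flagCycles_succ.1 hf).1).elim
  | n + 1, x, f, hf, y :: l, h => by
    rw [mem_flagCycles_succ] at hf
    have hy : y ⋖ x := by
      by_contra hy
      exact h (hf.2.2.1 y hy l)
    rw [List.length_cons, length_of_mem_flagCycles (hf.2.1 y hy) h]

theorem cons_mem_flagCycles {n : ℕ} {x : Q} {f : List Q → R} (hf : f ∈ flagCycles R (n + 1) x)
    {y : Q} (hy : y ⋖ x) : (fun l => f (y :: l)) ∈ flagCycles R n y :=
  (mem_flagCycles_succ.1 hf).2.1 y hy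

theorem covBy_of_mem_flagCycles {n : ℕ} {x : Q} {f : List Q → R} (hf : f ∈ flagCycles R n x)
    {y : Q} {l : List Q} (h : f (y :: l) ≠ 0) : y ⋖ x :=
  (List.isChain_cons_cons.1 (isChain_of_mem_flagCycles hf h)).1

variable [OrderBot Q] {p : ℕ} [Fact p.Prime]

/-- A flag cycle is determined by its restrictions to the hyperplanes avoiding a given atom. -/
theorem eq_zero_of_mem_flagCycles :
    ∀ {n : ℕ} {x a : Q} (_ : HasSubspaceRank p (n + 1) x) (_ : IsAtom a) (_ : a ≤ x)
      {f : List Q → R} (_ : f ∈ flagCycles R (n + 1) x)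
      (_ : ∀ y, y ⋖ x → ¬ a ≤ y → ∀ l, f (y :: l) = 0), f = 0 := by
  intro n
  induction n with
  | zero =>
    intro x a hx ha hax f hf h
    funext l
    match l with
    | [] => exact (mem_flagCycles_succ.1 hf).1
    | y :: l =>
      by_contra hne
      have hy := covBy_of_mem_flagCycles hf hne
      refine hne (h y hy (fun hay => ha.1 ?_) l)
      rw [(hx.of_covBy hy).eq_of_le hay, (hx.of_covBy hy).eq_of_le bot_le]
  | succ n ih =>
    intro x a hx ha hax f hf h
    funext l
    match l with
    | [] => exact (mem_flagCycles_succ.1 hf).1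
    | y :: l =>
      by_contra hne
      have hy := covBy_of_mem_flagCycles hf hne
      have hay : a ≤ y := by
        by_contra hay
        exact hne (h y hy hay l)
      refine hne (congrFun (ih (hx.of_covBy hy) ha hay (cons_mem_flagCycles hf hy) ?_) l)
      intro w hw haw l
      -- Below `x`, the only cover of `w` above `a` is `y`, and `f` vanishes on hyperplanes avoiding
      -- `a`. The cycle condition at `w` thus reduces to its single term at `y`.
      obtain ⟨y', -, -, huniq, -⟩ :=
        hx.exists_covBy_of_not_le ha hax (hw.le.trans hy.le) haw
      refine (Finset.sum_eq_single (f := fun z => f (z :: w :: l)) y (fun z _ hz => ?_)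
        fun h => (h (Finset.mem_univ _)).elim).symm.trans
        ((mem_flagCycles_succ.1 hf).2.2.2 w l)
      by_contra hne
      have hz' := covBy_of_mem_flagCycles hf hne
      have hwz := covBy_of_mem_flagCycles (cons_mem_flagCycles hf hz') hne
      have haz : a ≤ z := by
        by_contra haz
        exact hne (h z hz' haz _)
      exact hz ((huniq z hwz haz hz'.le).trans (huniq y hw hay hy.le).symm)

/-- Flag cycles on the hyperplanes avoiding a given atom extend to a flag cycle. -/
theorem exists_mem_flagCycles :
    ∀ {n : ℕ} {x a : Q} (_ : HasSubspaceRank p (n + 1) x) (_ : IsAtom a) (_ : a ≤ x)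
      (F : Q → List Q → R) (_ : ∀ y, F y ∈ flagCycles R n y)
      (_ : ∀ y, ¬ (y ⋖ x ∧ ¬ a ≤ y) → F y = 0),
      ∃ f ∈ flagCycles R (n + 1) x, ∀ y, ¬ a ≤ y → ∀ l, f (y :: l) = F y l := by
  classical
  intro n
  induction n with
  | zero =>
    intro x a hx ha hax F hF hF0
    refine ⟨fun l => match l with | [] => 0 | y :: l => F y l,
      mem_flagCycles_succ.2 ⟨rfl, fun y _ => hF y, fun y hy l => ?_, fun w l => ?_⟩,
      fun y _ l => rfl⟩
    · exact congrFun (hF0 y fun h => hy h.1) l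
    · exact Finset.sum_eq_zero fun y _ => mem_flagCycles_zero.1 (hF y) w l
  | succ n ih =>
    intro x a hx ha hax F hF hF0
    have hFw : ∀ w, (fun l => ∑ z, F z (w :: l)) ∈ flagCycles R n w := by
      intro w
      have : (fun l => ∑ z, F z (w :: l)) = ∑ z, fun l => F z (w :: l) := by
        funext l; simp
      rw [this]
      refine Submodule.sum_mem _ fun z _ => ?_
      by_cases hw : w ⋖ z
      · exact cons_mem_flagCycles (hF z) hw
      · convert Submodule.zero_mem (flagCycles R n w) using 1
        funext l
        exact (mem_flagCycles_succ.1 (hF z)).2.2.1 w hw l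
    -- On a hyperplane `y` containing `a`, the cycle condition at each `w ⋖ y` avoiding `a` forces
    -- the value of `g`, because `y` is the only cover of `w` that contains `a`. By induction these
    -- values extend to a flag cycle below `y`.
    have hext : ∀ y, ∃ g : List Q → R, g ∈ flagCycles R (n + 1) y ∧
        ((y ⋖ x ∧ a ≤ y) → ∀ w, w ⋖ y → ¬ a ≤ w → ∀ l, g (w :: l) = - ∑ z, F z (w :: l)) ∧
        (¬ (y ⋖ x ∧ a ≤ y) → g = 0) := by
      intro y
      by_cases hy : y ⋖ x ∧ a ≤ y
      · obtain ⟨g, hg, hgF⟩ := ih (hx.of_covBy hy.1) ha hy.2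
          (fun w => if w ⋖ y ∧ ¬ a ≤ w then fun l => - ∑ z, F z (w :: l) else 0)
          (fun w => by
            split_ifs
            · exact Submodule.neg_mem _ (hFw w)
            · exact Submodule.zero_mem _)
          (fun w hw => if_neg hw)
        refine ⟨g, hg, fun _ w hw haw l => ?_, fun h => (h hy).elim⟩
        rw [hgF w haw, if_pos ⟨hw, haw⟩]
      · exact ⟨0, Submodule.zero_mem _, fun h => (hy h).elim, fun _ => rfl⟩
    choose g hg hgF hg0 using hext
    have hmem : ∀ y, (fun l => g y l + F y l) ∈ flagCycles R (n + 1) y := fun y =>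
      Submodule.add_mem _ (hg y) (hF y)
    have hx0 : ∀ y, ¬ y ⋖ x → ∀ l, g y l + F y l = 0 := by
      intro y hy l
      rw [hg0 y fun h => hy h.1, hF0 y fun h => hy h.1]
      simp
    have avoid : ∀ w, ¬ a ≤ w → ∀ l, ∑ y, (g y (w :: l) + F y (w :: l)) = 0 := by
      intro w haw l
      by_cases hex : ∃ y, w ⋖ y ∧ y ⋖ x
      · obtain ⟨y, hwy, hyx⟩ := hex
        obtain ⟨w', hww', haw', huniq, hco⟩ :=
          hx.exists_covBy_of_not_le ha hax (hwy.le.trans hyx.le) haw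
        have hw'x := hco y hwy hyx
        rw [Finset.sum_add_distrib, Finset.sum_eq_single w' (fun z _ hz => ?_) (by simp),
          hgF w' ⟨hw'x, haw'⟩ w hww' haw, neg_add_cancel]
        by_contra hne
        have hz' : z ⋖ x ∧ a ≤ z := by
          by_contra hz'
          exact hne (congrFun (hg0 z hz') _)
        exact hz (huniq z (covBy_of_mem_flagCycles (hg z) hne) hz'.2 hz'.1.le)
      · refine Finset.sum_eq_zero fun y _ => ?_
        by_contra hne
        exact hex ⟨y, covBy_of_mem_flagCycles (hmem y) hne, by
          by_contra hy
          exact hne (hx0 y hy _)⟩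
    -- For `w` containing `a`, the sum is itself a flag cycle below `w`, so it suffices that it
    -- vanish on the hyperplanes `u` of `w` avoiding `a`.
    have glue : ∀ w l, ∑ y, (g y (w :: l) + F y (w :: l)) = 0 := by
      intro w l
      by_cases haw : a ≤ w
      swap
      · exact avoid w haw l
      by_cases hex : ∃ y, w ⋖ y ∧ y ⋖ x
      swap
      · refine Finset.sum_eq_zero fun y _ => ?_
        by_contra hne
        exact hex ⟨y, covBy_of_mem_flagCycles (hmem y) hne, by
          by_contra hy
          exact hne (hx0 y hy _)⟩
      obtain ⟨y, hwy, hyx⟩ := hex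
      have hw := (hx.of_covBy hyx).of_covBy hwy
      have hh : (fun l => ∑ y, (g y (w :: l) + F y (w :: l))) ∈ flagCycles R n w := by
        have : (fun l => ∑ y, (g y (w :: l) + F y (w :: l))) =
            ∑ y, fun l => g y (w :: l) + F y (w :: l) := by
          funext l; simp
        rw [this]
        refine Submodule.sum_mem _ fun z _ => ?_
        by_cases hw : w ⋖ z
        · exact cons_mem_flagCycles (hmem z) hw
        · convert Submodule.zero_mem (flagCycles R n w) using 1
          funext l
          exact (mem_flagCycles_succ.1 (hmem z)).2.2.1 w hw l
      match n, hw, hh with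
      | 0, hw, _ =>
        exact (ha.1 (by rw [hw.eq_of_le haw, hw.eq_of_le bot_le])).elim
      | m + 1, hw, hh =>
        refine congrFun (eq_zero_of_mem_flagCycles hw ha haw hh fun u hu hau l => ?_) l
        obtain ⟨w', -, -, huniq, -⟩ := hx.exists_covBy_of_not_le ha hax
          (hu.le.trans (hwy.le.trans hyx.le)) hau
        -- The cycle conditions at `u`, summed over all `y`. The terms with `v` avoiding `a` vanish
        -- by `avoid`, and the only possible `v` containing `a` is `w`.
        have htotal : ∑ v, ∑ y, (g y (v :: u :: l) + F y (v :: u :: l)) = 0 := by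
          rw [Finset.sum_comm]
          exact Finset.sum_eq_zero fun y _ => (mem_flagCycles_succ.1 (hmem y)).2.2.2 u l
        refine (Finset.sum_eq_single
          (f := fun v => ∑ y, (g y (v :: u :: l) + F y (v :: u :: l))) w (fun v _ hv => ?_)
          fun h => (h (Finset.mem_univ _)).elim).symm.trans htotal
        by_cases hav : a ≤ v
        swap
        · exact avoid v hav _
        refine Finset.sum_eq_zero fun y _ => ?_
        by_contra hne
        have hvy := covBy_of_mem_flagCycles (hmem y) hne
        have huv := covBy_of_mem_flagCycles (cons_mem_flagCycles (hmem y) hvy) hne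
        have hyx' : y ⋖ x := by
          by_contra hy
          exact hne (hx0 y hy _)
        exact hv ((huniq v huv hav (hvy.le.trans hyx'.le)).trans
          (huniq w hu haw (hwy.le.trans hyx.le)).symm)
    refine ⟨fun l => match l with | [] => 0 | y :: l => g y l + F y l,
      mem_flagCycles_succ.2 ⟨rfl, fun y _ => hmem y, hx0, glue⟩, fun y hay l => ?_⟩
    simp [hg0 y fun h => hay h.2]

/-- Restriction of flag cycles to the hyperplanes avoiding an atom. -/
noncomputable def flagCyclesRestrict (n : ℕ) (x a : Q) :
    flagCycles R (n + 1) x →ₗ[R] ∀ y : {y : Q // y ⋖ x ∧ ¬ a ≤ y}, flagCycles R n (y : Q) :=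
  LinearMap.pi fun y =>
    ((LinearMap.funLeft R R (fun l : List Q => y.1 :: l)).comp (flagCycles R (n + 1) x).subtype)
      |>.codRestrict _ fun f => cons_mem_flagCycles f.2 y.2.1

theorem flagCyclesRestrict_bijective {n : ℕ} {x a : Q} (hx : HasSubspaceRank p (n + 1) x)
    (ha : IsAtom a) (hax : a ≤ x) :
    Function.Bijective (flagCyclesRestrict (R := R) n x a) := by
  classical
  constructor
  · rw [← LinearMap.ker_eq_bot, LinearMap.ker_eq_bot']
    rintro ⟨f, hf⟩ h
    refine Subtype.ext (eq_zero_of_mem_flagCycles hx ha hax hf fun y hy hay l => ?_)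
    exact congrFun (congrArg Subtype.val (congrFun h ⟨y, hy, hay⟩)) l
  · intro G
    obtain ⟨f, hf, hfG⟩ := exists_mem_flagCycles hx ha hax
      (fun y => if h : y ⋖ x ∧ ¬ a ≤ y then (G ⟨y, h⟩ : List Q → R) else 0)
      (fun y => by
        split_ifs with h
        · exact (G ⟨y, h⟩).2
        · exact Submodule.zero_mem _)
      (fun y h => dif_neg h)
    refine ⟨⟨f, hf⟩, funext fun y => Subtype.ext (funext fun l => ?_)⟩
    refine (hfG y y.2.2 l).trans ?_
    rw [dif_pos y.2]

/-- The flag cycles below an element of rank `n` form a free module of rank `p ^ (n choose 2)`. -/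
theorem nonempty_flagCycles_equiv :
    ∀ {n : ℕ} {x : Q} (_ : HasSubspaceRank p n x),
      Nonempty (flagCycles R n x ≃ₗ[R] (Fin (p ^ n.choose 2) → R))
  | 0, x, _ => by
    refine ⟨LinearEquiv.trans (LinearEquiv.ofBijective
      ((LinearMap.proj []).comp (flagCycles R 0 x).subtype) ⟨?_, fun r => ?_⟩)
      (LinearEquiv.funUnique (Fin 1) R R).symm⟩
    · rw [← LinearMap.ker_eq_bot, LinearMap.ker_eq_bot']
      rintro ⟨f, hf⟩ h
      refine Subtype.ext (funext fun l => ?_)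
      cases l with
      | nil => exact h
      | cons y l => exact mem_flagCycles_zero.1 hf y l
    · exact ⟨⟨fun l => match l with | [] => r | _ :: _ => 0,
        mem_flagCycles_zero.2 fun _ _ => rfl⟩, rfl⟩
  | n + 1, x, hx => by
    obtain ⟨a, ha, hax⟩ := hx.exists_isAtom_le
    have e : ∀ y : {y : Q // y ⋖ x ∧ ¬ a ≤ y},
        flagCycles R n (y : Q) ≃ₗ[R] (Fin (p ^ n.choose 2) → R) := fun y =>
      (nonempty_flagCycles_equiv (hx.of_covBy y.2.1)).some
    -- Pascal's rule: `n + n.choose 2 = (n + 1).choose 2`.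
    have hc : Nat.card ({y : Q // y ⋖ x ∧ ¬ a ≤ y} × Fin (p ^ n.choose 2)) =
        p ^ (n + 1).choose 2 := by
      rw [Nat.card_prod, hx.card_covBy_not_le ha hax, Nat.card_fin, ← pow_add,
        Nat.choose_succ_succ' n 1, Nat.choose_one_right]
    exact ⟨(LinearEquiv.ofBijective _ (flagCyclesRestrict_bijective hx ha hax)).trans
      ((LinearEquiv.piCongrRight e).trans ((LinearEquiv.curry R R _ _).symm.trans
        (LinearEquiv.funCongrLeft R R (Finite.equivFinOfCardEq hc).symm)))⟩

end FlagCycles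

/-! ### Subspace lattices from Quillen posets -/

section QuillenPoset

/-- Subgroups of `C_p ^ n` are the subspaces of `𝔽_p ^ n`. -/
noncomputable def subgroupOrderIsoSubmodule (p n : ℕ) :
    Subgroup (Fin n → Multiplicative (ZMod p)) ≃o Submodule (ZMod p) (Fin n → ZMod p) :=
  (MulEquiv.piMultiplicative fun _ : Fin n => ZMod p).symm.mapSubgroup.trans
    (AddSubgroup.toSubgroup.symm.trans (AddSubgroup.toZModSubmodule p))

theorem isElemAbelian_pi_zmod {p n : ℕ} (H : Subgroup (Fin n → Multiplicative (ZMod p))) :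
    IsElemAbelian p H := by
  refine ⟨fun a _ b _ => mul_comm a b, fun a _ => funext fun i => ?_⟩
  rw [Pi.pow_apply, Pi.one_apply]
  apply Multiplicative.toAdd.injective
  rw [toAdd_pow, toAdd_one, nsmul_eq_mul, CharP.cast_eq_zero, zero_mul]

/-- `𝒜_p(C_p ^ n)` is the poset of non-zero subspaces of `𝔽_p ^ n`. -/
noncomputable def quillenPosetOrderIso (p n : ℕ) :
    QuillenPoset p (Fin n → Multiplicative (ZMod p)) ≃o
      {S : Submodule (ZMod p) (Fin n → ZMod p) // S ≠ ⊥} where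
  toEquiv := (subgroupOrderIsoSubmodule p n).toEquiv.subtypeEquiv fun H => by
    rw [and_iff_left (isElemAbelian_pi_zmod H)]
    exact not_congr (map_eq_bot_iff (subgroupOrderIsoSubmodule p n)).symm
  map_rel_iff' := (subgroupOrderIsoSubmodule p n).le_iff_le

variable {P : Type*} [PartialOrder P]

/-- The non-bottom elements of a principal lower set of `WithBot P`. -/
def iicWithBotOrderIso (x : P) :
    Set.Iic x ≃o {a : Set.Iic (x : WithBot P) // a ≠ ⊥} where
  toFun b := ⟨⟨((b : P) : WithBot P), WithBot.coe_le_coe.2 b.2⟩, fun h =>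
    WithBot.coe_ne_bot (congrArg Subtype.val h)⟩
  invFun a := ⟨WithBot.unbot a.1.1 fun h => a.2 (Subtype.ext h), by
    rw [Set.mem_Iic, ← WithBot.coe_le_coe, WithBot.coe_unbot]; exact a.1.2⟩
  left_inv b := rfl
  right_inv a := Subtype.ext (Subtype.ext (WithBot.coe_unbot _ _))
  map_rel_iff' := WithBot.coe_le_coe

/-- The adjoined bottom plays the role of the zero subspace, which `𝒜_p` leaves out. -/
theorem IsLocallyQuillen.hasSubspaceRank [GradeMinOrder ℕ P] {p : ℕ}
    (hP : IsLocallyQuillen p P) (x : P) :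
    HasSubspaceRank p (grade ℕ x + 1) (x : WithBot P) := by
  classical
  obtain ⟨e⟩ := hP x
  exact ⟨WithBot.subtypeOrderIso.symm.trans
    ((((iicWithBotOrderIso x).symm.trans e).trans (quillenPosetOrderIso p _)).withBotCongr.trans
      WithBot.subtypeOrderIso)⟩

end QuillenPoset

/-! ### Chains as descending lists -/

section FlagList

variable {P : Type*} [PartialOrder P]

/-- The descending list of the elements of a chain in `P`, followed by `⊥`. -/
def flagList {k : ℕ} (e : Fin k ↪o P) : List (WithBot P) :=
  List.ofFn fun j : Fin (k + 1) =>
    if h : (j : ℕ) < k then ((e ⟨k - 1 - j, by omega⟩ : P) : WithBot P) else ⊥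

@[simp]
theorem length_flagList {k : ℕ} (e : Fin k ↪o P) : (flagList e).length = k + 1 := by
  simp [flagList]

theorem getElem_flagList {k : ℕ} (e : Fin k ↪o P) (j : ℕ) (hj : j < (flagList e).length) :
    (flagList e)[j] = if h : j < k then ((e ⟨k - 1 - j, by omega⟩ : P) : WithBot P) else ⊥ := by
  simp only [flagList, List.getElem_ofFn]

theorem flagList_injective (k : ℕ) : Function.Injective (flagList : (Fin k ↪o P) → _) := by
  intro e e' h
  ext i
  have hi := i.2
  have h1 : (flagList e)[k - 1 - i]'(by simp; omega) = (flagList e')[k - 1 - i]'(by simp; omega) := by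
    simp [h]
  rw [getElem_flagList, getElem_flagList, dif_pos (by omega), dif_pos (by omega),
    WithBot.coe_inj] at h1
  have hidx : (⟨k - 1 - (k - 1 - i), by omega⟩ : Fin k) = i := Fin.ext (by simp only; omega)
  rwa [hidx] at h1

/-- In a strictly decreasing list `⊥` can only come last; the entries before it, reversed, form the
chain. -/
theorem exists_flagList_eq {k : ℕ} {l : List (WithBot P)} (hl : l.length = k + 1)
    (hbot : ⊥ ∈ l) (hc : l.Pairwise (fun a b => b < a)) : ∃ e : Fin k ↪o P, flagList e = l := by
  rw [List.pairwise_iff_getElem] at hc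
  have hlast : l[k] = ⊥ := by
    obtain ⟨m, hm, hml⟩ := List.getElem_of_mem hbot
    rcases (show m ≤ k by omega).lt_or_eq with h | rfl
    · exact absurd (hc m k hm (by omega) h) (by simp [hml])
    · exact hml
  have hex : ∀ i : Fin k, ∃ a : P, (a : WithBot P) = l[k - 1 - i] := by
    intro i
    have hi := i.2
    have := hc (k - 1 - i) k (by omega) (by omega) (by omega)
    exact WithBot.ne_bot_iff_exists.1 (bot_le.trans_lt this).ne'
  choose a ha using hex
  have hmono : StrictMono a := by
    intro i j hij
    have hi := i.2
    have hj := j.2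
    rw [← WithBot.coe_lt_coe, ha, ha]
    exact hc _ _ (by omega) (by omega) (by omega)
  refine ⟨OrderEmbedding.ofStrictMono a hmono, List.ext_getElem (by simp [hl]) fun j h1 h2 => ?_⟩
  rw [getElem_flagList]
  split_ifs with h
  · rw [OrderEmbedding.coe_ofStrictMono, ha]
    congr 1
    simp only
    omega
  · rw [length_flagList] at h1
    obtain rfl : j = k := by omega
    exact hlast.symm

/-- Deleting the `i`-th vertex of a chain deletes an entry of its list. -/
theorem flagList_eq_insert {k : ℕ} (e : Fin (k + 1) ↪o P) (i : Fin (k + 1)) :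
    flagList e = (flagList ((Fin.succAboveOrderEmb i).trans e)).take (k - i) ++
      (e i : WithBot P) :: (flagList ((Fin.succAboveOrderEmb i).trans e)).drop (k - i) := by
  have hi := i.2
  have hlen : ((flagList ((Fin.succAboveOrderEmb i).trans e)).take (k - i)).length = k - i := by
    rw [List.length_take, length_flagList]
    omega
  refine List.ext_getElem (by
    rw [List.length_append, hlen, List.length_cons, List.length_drop, length_flagList,
      length_flagList]
    omega) fun j h1 h2 => ?_
  rw [length_flagList] at h1
  rw [getElem_flagList]
  -- The list is descending, so vertex `i` of the `k + 1` vertices sits at position `k - i`.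
  rcases lt_trichotomy j (k - i) with h | h | h
  · rw [List.getElem_append_left (by omega), List.getElem_take, getElem_flagList,
      dif_pos (by omega), dif_pos (by omega)]
    refine congrArg WithBot.some (congrArg e (Fin.ext ?_))
    change _ = ((i.succAbove _ : Fin _) : ℕ)
    simp only [Fin.succAbove, Fin.lt_def, Fin.val_castSucc,
      apply_ite Fin.val, Fin.val_succ]
    split_ifs <;> omega
  · subst h
    rw [List.getElem_append_right (by omega), dif_pos (by omega)]
    simp only [hlen, Nat.sub_self, List.getElem_cons_zero]
    refine congrArg WithBot.some (congrArg e (Fin.ext ?_))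
    simp only
    omega
  · rw [List.getElem_append_right (by omega)]
    simp only [hlen]
    have hj0 : j - (k - i) ≠ 0 := by omega
    rw [List.getElem_cons, dif_neg hj0, List.getElem_drop, getElem_flagList]
    by_cases hj : j < k + 1
    · rw [dif_pos hj, dif_pos (by omega)]
      refine congrArg WithBot.some (congrArg e (Fin.ext ?_))
      change _ = ((i.succAbove _ : Fin _) : ℕ)
      simp only [Fin.succAbove, Fin.lt_def, Fin.val_castSucc,
        apply_ite Fin.val, Fin.val_succ]
      split_ifs <;> omega
    · rw [dif_neg hj, dif_neg (by omega)]

end FlagList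

/-! ### Top cycles of the order complex -/

section TopCycles

variable {R : Type*} [CommRing R] {P : Type*} [PartialOrder P]

theorem isEmpty_orderEmbedding_of_hasDim [GradeMinOrder ℕ P] {N : ℕ} (hN : HasDim P N) :
    IsEmpty (Fin (N + 2) ↪o P) := by
  refine ⟨fun e => ?_⟩
  have hle : ∀ x : P, grade ℕ x ≤ N := fun x => hN.2 ⟨x, rfl⟩
  have hmono : StrictMono fun i => grade ℕ (e i) := grade_strictMono.comp e.strictMono
  have := Fintype.card_le_of_injective
    (fun i => (⟨grade ℕ (e i), Nat.lt_succ_of_le (hle _)⟩ : Fin (N + 1)))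
    fun i j h => hmono.injective (congrArg Fin.val h)
  simp at this

/-- There are no chains with `N + 2` elements, hence no non-zero boundaries in degree `N`. -/
theorem eq_zero_of_orderBoundary_eq_zero [GradeMinOrder ℕ P] {N : ℕ} (hN : HasDim P N)
    (hH : Subsingleton (ReducedHomology R P N)) {c : OrderChains R P (N + 1)}
    (hc : orderBoundary R P N c = 0) : c = 0 := by
  rw [Submodule.Quotient.subsingleton_iff] at hH
  have hmem : (⟨c, hc⟩ : orderCycles R P N) ∈ orderBoundaries R P N := hH ▸ Submodule.mem_top
  obtain ⟨b, hb⟩ := hmem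
  have := isEmpty_orderEmbedding_of_hasDim hN
  have hb0 : b = 0 := Finsupp.ext fun e => (IsEmpty.false e).elim
  rw [hb0, map_zero] at hb
  exact hb.symm

variable [Finite P]

theorem mapDomain_apply_eq_sum_filter {α β M : Type*} [Fintype α] [DecidableEq β]
    [AddCommMonoid M] (f : α → β) (x : α →₀ M) (b : β) :
    Finsupp.mapDomain f x b = ∑ a with f a = b, x a := by
  classical
  rw [Finsupp.mapDomain, Finsupp.sum_fintype _ _ (by simp), Finsupp.finsetSum_apply,
    Finset.sum_filter]
  simp [Finsupp.single_apply]

/-- A function on descending lists as a chain of the order complex. -/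
noncomputable def chainOfFlagFunction (k : ℕ) (g : List (WithBot P) → R) : OrderChains R P k :=
  have : Finite (Fin k ↪o P) := DFunLike.finite _
  Finsupp.equivFunOnFinite.symm fun e => g (flagList e)

theorem chainOfFlagFunction_apply (k : ℕ) (g : List (WithBot P) → R) (e : Fin k ↪o P) :
    (show (Fin k ↪o P) →₀ R from chainOfFlagFunction k g) e = g (flagList e) :=
  rfl

/-- A function on descending lists which satisfies the cycle condition at every position gives
a cycle of the order complex. -/
theorem orderBoundary_chainOfFlagFunction [Fintype (WithBot P)] {k : ℕ}
    {g : List (WithBot P) → R}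
    (hsupp : ∀ l, g l ≠ 0 → ∃ e : Fin (k + 1) ↪o P, flagList e = l)
    (hg : ∀ l₁ w l₂, ∑ y, g (l₁ ++ y :: w :: l₂) = 0) :
    orderBoundary R P k (chainOfFlagFunction (k + 1) g) = 0 := by
  classical
  have : Finite (Fin (k + 1) ↪o P) := DFunLike.finite _
  have := Fintype.ofFinite (Fin (k + 1) ↪o P)
  rw [orderBoundary, LinearMap.sum_apply]
  -- Each face map kills the chain separately, so the signs play no role.
  refine Finset.sum_eq_zero fun i _ => ?_
  have hi := i.2
  rw [LinearMap.smul_apply]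
  convert smul_zero _
  refine Finsupp.ext fun e' => ?_
  refine (mapDomain_apply_eq_sum_filter _ _ _).trans ?_
  -- The final `⊥` guarantees an entry after the deleted vertex, even for the smallest vertex `i =
  -- 0`.
  have hne : (flagList e').drop (k - i) ≠ [] := by
    intro h
    have := congrArg List.length h
    simp at this
    omega
  obtain ⟨w, l₂, hwl⟩ := List.exists_cons_of_ne_nil hne
  have hface : ∀ e : Fin (k + 1) ↪o P, (Fin.succAboveOrderEmb i).trans e = e' →
      flagList e = (flagList e').take (k - i) ++ (e i : WithBot P) :: w :: l₂ := by
    rintro e rfl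
    rw [← hwl]
    exact flagList_eq_insert e i
  refine Eq.trans ?_ (hg ((flagList e').take (k - i)) w l₂)
  refine Finset.sum_of_injOn (fun e : Fin (k + 1) ↪o P => (e i : WithBot P)) ?_ ?_ ?_ ?_
  · intro e he e₂ he₂ h
    have he : (Fin.succAboveOrderEmb i).trans e = e' := by simpa using he
    have he₂ : (Fin.succAboveOrderEmb i).trans e₂ = e' := by simpa using he₂
    exact flagList_injective _ ((hface e he).trans
      ((congrArg (fun y => (flagList e').take (k - i) ++ y :: w :: l₂) h).trans
        (hface e₂ he₂).symm))
  · intro e he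
    simp
  · intro y _ hy
    by_contra hgy
    obtain ⟨e, he⟩ := hsupp _ hgy
    have h1 := (flagList_eq_insert e i).symm.trans he
    obtain ⟨h2, h3⟩ := List.append_inj h1 (by simp)
    rw [List.cons.injEq, ← hwl] at h3
    refine hy ⟨e, ?_, h3.1⟩
    simp only [Finset.coe_filter, Finset.mem_univ, true_and, Set.mem_ofPred_eq]
    apply flagList_injective
    rw [← List.take_append_drop (k - i) (flagList e'), ← h2, ← h3.2, List.take_append_drop]
  · intro e he
    rw [Finset.mem_filter] at he
    exact congrArg g (hface e he.2)

end TopCycles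

/-! ### The rank inequality -/

section RankInequality

theorem bot_mem_of_mem_flagCycles {R : Type*} [CommRing R] {Q : Type*} [PartialOrder Q]
    [Fintype Q] [OrderBot Q] {p : ℕ} [Fact p.Prime] :
    ∀ {n : ℕ} {x : Q} (_ : HasSubspaceRank p n x) {f : List Q → R} (_ : f ∈ flagCycles R n x)
      {l : List Q} (_ : f l ≠ 0), ⊥ ∈ x :: l
  | 0, x, hx, _, _, _, _ => by simp [hx.eq_of_le bot_le]
  | n + 1, x, hx, f, hf, [], h => (h (mem_flagCycles_succ.1 hf).1).elim
  | n + 1, x, hx, f, hf, y :: l, h => by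
    have hy := covBy_of_mem_flagCycles hf h
    exact List.mem_cons_of_mem _
      (bot_mem_of_mem_flagCycles (hx.of_covBy hy) (cons_mem_flagCycles hf hy) h)

variable {R : Type*} [CommRing R] {P : Type*} [PartialOrder P] [Finite P] [GradeMinOrder ℕ P]
  {p N : ℕ} [Fact p.Prime]

/-- If `H̃_N(|P|; R) = 0`, then a family of flag cycles below the objects of dimension `N` which
agree up to cancellation on each object of dimension `N - 1` is zero. -/
theorem flagCycles_eq_zero_of_sum_eq_zero [Fintype (WithBot P)] (hN : HasDim P N)
    (hH : Subsingleton (ReducedHomology R P N))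
    (f : WithBot P → List (WithBot P) → R)
    (hf : ∀ x, f x ∈ flagCycles R (N + 1) x)
    (hf0 : ∀ x, ¬ HasSubspaceRank p (N + 1) x → f x = 0)
    (hsum : ∀ w l, ∑ x, f x (w :: l) = 0) (x : WithBot P) : f x = 0 := by
  -- Prepending `x` joins the family into one function on full flags. `hsum` is the cycle condition
  -- for deleting the top vertex; the others hold within each `f x`.
  let g : List (WithBot P) → R := fun l => match l with
    | [] => 0
    | x :: l => f x l
  have hsupp : ∀ l, g l ≠ 0 → ∃ e : Fin (N + 1) ↪o P, flagList e = l := by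
    intro l hl
    match l, hl with
    | [], hl => exact (hl rfl).elim
    | x :: l, hl =>
      replace hl : f x l ≠ 0 := hl
      have hx : HasSubspaceRank p (N + 1) x := by
        by_contra hx
        exact hl (congrFun (hf0 x hx) l)
      refine exists_flagList_eq (by rw [List.length_cons, length_of_mem_flagCycles (hf x) hl])
        (bot_mem_of_mem_flagCycles hx (hf x) hl) ?_
      have := (isChain_of_mem_flagCycles (hf x) hl).imp (S := fun a b => b < a)
        fun a b h => h.lt
      have tr : IsTrans (WithBot P) (fun a b => b < a) := ⟨fun a b c h h' => h'.trans h⟩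
      exact List.isChain_iff_pairwise.1 this
  have hg : ∀ l₁ w l₂, ∑ y, g (l₁ ++ y :: w :: l₂) = 0 := by
    intro l₁ w l₂
    match l₁ with
    | [] => exact hsum w l₂
    | x :: l₁ => exact sum_insert_eq_zero_of_mem_flagCycles (hf x) l₁
  have hc := eq_zero_of_orderBoundary_eq_zero hN hH (orderBoundary_chainOfFlagFunction hsupp hg)
  funext l
  by_contra hne
  obtain ⟨e, he⟩ := hsupp (x :: l) hne
  refine hne ?_
  change g (x :: l) = 0
  rw [← he, ← chainOfFlagFunction_apply (N + 1) g, hc]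
  rfl

/-- An injection between finite free modules over a non-trivial commutative ring cannot lower the
rank, so `R` need not be a field. Covered elements are taken in `WithBot P` so that `N = 0` is
included, where the only one is `⊥`. -/
theorem card_mul_pow_le [Nontrivial R] (hP : IsLocallyQuillen p P)
    (hN : HasDim P N) (hH : Subsingleton (ReducedHomology R P N)) :
    Nat.card {x : P // grade ℕ x = N} * p ^ N ≤
      Nat.card {w : WithBot P // ∃ x : P, grade ℕ x = N ∧ w ⋖ (x : WithBot P)} := by
  classical
  have := Fintype.ofFinite (WithBot P)
  set A := {x : P // grade ℕ x = N}
  set M := {w : WithBot P // ∃ x : P, grade ℕ x = N ∧ w ⋖ (x : WithBot P)}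
  have := Fintype.ofFinite A
  have := Fintype.ofFinite M
  have hA : ∀ x : A, HasSubspaceRank p (N + 1) ((x : P) : WithBot P) := fun x => by
    have := hP.hasSubspaceRank (x : P)
    rwa [x.2] at this
  have hM : ∀ w : M, HasSubspaceRank p N (w : WithBot P) := by
    rintro ⟨w, x, hx, hw⟩
    exact (hA ⟨x, hx⟩).of_covBy hw
  have hmem : ∀ (w : M) (x : A) (f : flagCycles R (N + 1) ((x : P) : WithBot P)),
      (LinearMap.funLeft R R (fun l : List (WithBot P) => w.1 :: l)) f.1 ∈
        flagCycles R N (w : WithBot P) := by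
    intro w x f
    by_cases h : (w : WithBot P) ⋖ ((x : P) : WithBot P)
    · exact cons_mem_flagCycles f.2 h
    · convert Submodule.zero_mem (flagCycles R N (w : WithBot P)) using 1
      funext l
      exact (mem_flagCycles_succ.1 f.2).2.2.1 _ h l
  let Φ : (∀ x : A, flagCycles R (N + 1) ((x : P) : WithBot P)) →ₗ[R]
      ∀ w : M, flagCycles R N (w : WithBot P) :=
    LinearMap.pi fun w => ∑ x : A,
      (((LinearMap.funLeft R R (fun l : List (WithBot P) => w.1 :: l)).comp
        (flagCycles R (N + 1) ((x : P) : WithBot P)).subtype).codRestrict _ (hmem w x)).comp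
        (LinearMap.proj x)
  have hΦ : ∀ F w l, (Φ F w : List (WithBot P) → R) l =
      ∑ x : A, (F x : List (WithBot P) → R) (w.1 :: l) := by
    intro F w l
    simp only [Φ, LinearMap.pi_apply, LinearMap.sum_apply, AddSubmonoidClass.coe_finsetSum,
      Finset.sum_apply]
    rfl
  have hinj : Function.Injective Φ := by
    rw [← LinearMap.ker_eq_bot, LinearMap.ker_eq_bot']
    intro F hF
    -- The family `F`, extended by zero to all of `WithBot P`.
    let f : WithBot P → List (WithBot P) → R := fun z =>
      ∑ x : A, if ((x : P) : WithBot P) = z then (F x : List (WithBot P) → R) else 0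
    have hfx : ∀ x : A, f ((x : P) : WithBot P) = F x := by
      intro x
      simp only [f, WithBot.coe_inj, Subtype.coe_inj]
      rw [Finset.sum_ite_eq' Finset.univ x]
      simp
    have hf0 : ∀ z, (∀ x : A, ((x : P) : WithBot P) ≠ z) → f z = 0 := fun z hz =>
      Finset.sum_eq_zero fun x _ => if_neg (hz x)
    have hcases : ∀ z, (∃ x : A, ((x : P) : WithBot P) = z) ∨ f z = 0 := by
      intro z
      by_cases h : ∃ x : A, ((x : P) : WithBot P) = z
      · exact Or.inl h
      · exact Or.inr (hf0 z fun x hx => h ⟨x, hx⟩)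
    have hz := flagCycles_eq_zero_of_sum_eq_zero hN hH f
      (fun z => by
        rcases hcases z with ⟨x, rfl⟩ | h
        · rw [hfx]; exact (F x).2
        · rw [h]; exact Submodule.zero_mem _)
      (fun z hz => by
        rcases hcases z with ⟨x, rfl⟩ | h
        · exact (hz (hA x)).elim
        · exact h)
      (fun w l => by
        have h1 : ∑ z, f z (w :: l) = ∑ x : A, (F x : List (WithBot P) → R) (w :: l) := by
          simp only [f, Finset.sum_apply]
          rw [Finset.sum_comm]
          refine Finset.sum_congr rfl fun x _ => ?_
          rw [Finset.sum_eq_single ((x : P) : WithBot P)]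
          · simp
          · intro z _ hz
            rw [if_neg hz.symm]; rfl
          · simp
        rw [h1]
        by_cases hw : ∃ x : P, grade ℕ x = N ∧ w ⋖ (x : WithBot P)
        · rw [← hΦ F ⟨w, hw⟩ l, hF]
          rfl
        · refine Finset.sum_eq_zero fun x _ => ?_
          exact (mem_flagCycles_succ.1 (F x).2).2.2.1 w (fun h => hw ⟨x, x.2, h⟩) l)
    funext x
    refine Subtype.ext ?_
    rw [← hfx, hz]
    rfl
  let eA := (LinearEquiv.piCongrRight fun x : A =>
    (nonempty_flagCycles_equiv (R := R) (hA x)).some).trans (LinearEquiv.curry R R _ _).symm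
  let eM := (LinearEquiv.piCongrRight fun w : M =>
    (nonempty_flagCycles_equiv (R := R) (hM w)).some).trans (LinearEquiv.curry R R _ _).symm
  have hcard := card_le_of_injective R
    (eM.toLinearMap ∘ₗ Φ ∘ₗ eA.symm.toLinearMap)
    (eM.injective.comp (hinj.comp eA.symm.injective))
  rw [Fintype.card_prod, Fintype.card_prod, Fintype.card_fin, Fintype.card_fin,
    Nat.choose_succ_succ' N 1, Nat.choose_one_right, pow_add, ← mul_assoc] at hcard
  rw [Nat.card_eq_fintype_card, Nat.card_eq_fintype_card]
  exact Nat.le_of_mul_le_mul_right hcard (pow_pos (Fact.out : p.Prime).pos _)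

end RankInequality

/-! ### Counting free objects -/

section Counting

variable {P : Type*} [PartialOrder P] [GradeMinOrder ℕ P] {p N : ℕ}

theorem mem_nonMaximalCodimOne_iff {y : P} :
    y ∈ nonMaximalCodimOne P N ↔ ∃ x : P, grade ℕ x = N ∧ y ⋖ x := by
  constructor
  · rintro ⟨h1, h2⟩
    obtain ⟨x, hx⟩ := exists_covBy_of_wellFoundedLT h2
    exact ⟨x, by rw [← h1]; exact (Nat.covBy_iff_add_one_eq.1 (hx.grade ℕ)).symm, hx⟩
  · rintro ⟨x, hx, hyx⟩
    exact ⟨by rw [← hx]; exact Nat.covBy_iff_add_one_eq.1 (hyx.grade ℕ),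
      fun h => hyx.lt.not_ge (h hyx.le)⟩

theorem HasDim.isMax (hN : HasDim P N) {x : P} (hx : grade ℕ x = N) : IsMax x := by
  intro y hxy
  rcases hxy.lt_or_eq with h | h
  · have := grade_strictMono (𝕆 := ℕ) h
    have h2 : grade ℕ y ≤ N := hN.2 ⟨y, rfl⟩
    omega
  · exact h.ge

/-- An object of dimension `N - 1` which is not free is covered by two objects. -/
theorem exists_ne_covBy_of_not_free (hN : HasDim P N) {y : P} (hy : y ∈ nonMaximalCodimOne P N)
    (hfree : y ∉ freeCodimOne P N) :
    ∃ x z : P, (grade ℕ x = N ∧ y ⋖ x) ∧ (grade ℕ z = N ∧ y ⋖ z) ∧ x ≠ z := by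
  obtain ⟨x, hx, hyx⟩ := mem_nonMaximalCodimOne_iff.1 hy
  have hne : ∃ z, (IsMax z ∧ y < z) ∧ z ≠ x := by
    by_contra! h
    exact hfree ⟨hy, hy.2, x, ⟨hN.isMax hx, hyx.lt⟩, h⟩
  obtain ⟨z, ⟨-, hyz⟩, hzx⟩ := hne
  have hz : grade ℕ z = N := by
    have h1 := grade_strictMono (𝕆 := ℕ) hyz
    have h2 : grade ℕ z ≤ N := hN.2 ⟨z, rfl⟩
    have h3 := hy.1
    omega
  have hyz' : y ⋖ z := covBy_iff_lt_covBy_grade.2 ⟨hyz, by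
    rw [Nat.covBy_iff_add_one_eq, hz, hy.1]⟩
  exact ⟨x, z, ⟨hx, hyx⟩, ⟨hz, hyz'⟩, hzx.symm⟩

variable [Finite P]

/-- Double counting of the covering relations between dimensions `N - 1` and `N`. -/
theorem two_mul_card_le (hN : HasDim P N) {c : ℕ}
    (hc : ∀ x : P, grade ℕ x = N → Nat.card {y : P // y ⋖ x} ≤ c) :
    2 * (nonMaximalCodimOne P N).ncard ≤
      Nat.card {x : P // grade ℕ x = N} * c + (freeCodimOne P N).ncard := by
  classical
  have := Fintype.ofFinite P
  let M : Finset P := (nonMaximalCodimOne P N).toFinset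
  let F : Finset P := (freeCodimOne P N).toFinset
  let A : Finset P := {x | grade ℕ x = N}
  have hFM : F ⊆ M := fun y hy => by
    rw [Set.mem_toFinset] at hy ⊢
    exact hy.1
  -- A free object has at least one cover of dimension `N` and gets a bonus of one; a non-free
  -- object has at least two such covers.
  have hlow : ∀ y ∈ M, 2 ≤ (A.bipartiteAbove (· ⋖ ·) y).card + if y ∈ F then 1 else 0 := by
    intro y hy
    rw [Set.mem_toFinset] at hy
    split_ifs with hyF
    · obtain ⟨x, hx, hyx⟩ := mem_nonMaximalCodimOne_iff.1 hy
      have : 0 < (A.bipartiteAbove (· ⋖ ·) y).card :=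
        Finset.card_pos.2 ⟨x, by simp [Finset.mem_bipartiteAbove, A, hx, hyx]⟩
      omega
    · rw [Set.mem_toFinset] at hyF
      obtain ⟨x, z, ⟨hx, hyx⟩, ⟨hz, hyz⟩, hxz⟩ := exists_ne_covBy_of_not_free hN hy hyF
      exact Finset.one_lt_card.2 ⟨x, by simp [Finset.mem_bipartiteAbove, A, hx, hyx],
        z, by simp [Finset.mem_bipartiteAbove, A, hz, hyz], hxz⟩
  have hup : ∀ x ∈ A, (M.bipartiteBelow (· ⋖ ·) x).card ≤ c := by
    intro x hx
    refine le_trans ?_ (hc x (by simpa [A] using hx))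
    rw [Nat.card_eq_fintype_card, Fintype.card_subtype]
    exact Finset.card_le_card fun y hy => by
      simpa using ((Finset.mem_bipartiteBelow _).1 hy).2
  have hsum := Finset.sum_le_sum hlow
  rw [Finset.sum_add_distrib, Finset.sum_card_bipartiteAbove_eq_sum_card_bipartiteBelow,
    Finset.sum_const, smul_eq_mul, ← Finset.sum_filter, Finset.filter_mem_eq_inter,
    Finset.inter_eq_right.2 hFM, ← Finset.card_eq_sum_ones] at hsum
  have hsum' := Finset.sum_le_card_nsmul A _ c hup
  rw [smul_eq_mul] at hsum'
  rw [Set.ncard_eq_toFinset_card', Set.ncard_eq_toFinset_card', Nat.card_eq_fintype_card,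
    Fintype.card_subtype]
  change 2 * M.card ≤ A.card * c + F.card
  omega

/-- Only an inequality: for `N = 0` the covered element `⊥` of `WithBot P` is not in `P`. -/
theorem card_covBy_le [Fact p.Prime] (hP : IsLocallyQuillen p P) {x : P} (hx : grade ℕ x = N) :
    Nat.card {y : P // y ⋖ x} * (p - 1) ≤ p ^ (N + 1) - 1 := by
  have h := hP.hasSubspaceRank x
  rw [hx] at h
  rw [← h.card_covBy]
  refine Nat.mul_le_mul_right _ (Nat.card_le_card_of_injective
    (fun y : {y : P // y ⋖ x} => (⟨((y : P) : WithBot P), WithBot.coe_covBy_coe.2 y.2⟩ :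
      {z : WithBot P // z ⋖ (x : WithBot P)})) fun y z h => ?_)
  exact Subtype.ext (WithBot.coe_injective (congrArg Subtype.val h))

/-- Below an object of positive dimension, every covered element of `WithBot P` lies in `P`. -/
theorem card_withBot_le (hN : N ≠ 0) :
    Nat.card {w : WithBot P // ∃ x : P, grade ℕ x = N ∧ w ⋖ (x : WithBot P)} ≤
      (nonMaximalCodimOne P N).ncard := by
  refine Nat.card_le_card_of_surjective (fun y : nonMaximalCodimOne P N =>
    (⟨((y : P) : WithBot P), by
      obtain ⟨x, hx, hyx⟩ := mem_nonMaximalCodimOne_iff.1 y.2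
      exact ⟨x, hx, WithBot.coe_covBy_coe.2 hyx⟩⟩ :
      {w : WithBot P // ∃ x : P, grade ℕ x = N ∧ w ⋖ (x : WithBot P)})) ?_
  rintro ⟨w, x, hx, hwx⟩
  induction w with
  | bot =>
    have hmin : IsMin x := WithBot.bot_covBy_coe.1 hwx
    have := hmin.grade ℕ
    rw [hx, isMin_iff_eq_bot] at this
    exact (hN this).elim
  | coe y =>
    exact ⟨⟨y, mem_nonMaximalCodimOne_iff.2 ⟨x, hx, WithBot.coe_covBy_coe.1 hwx⟩⟩, rfl⟩

/-- An object of dimension zero in a zero-dimensional poset with at most one object of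
dimension zero is a smallest element. -/
theorem isBot_of_card_le_one (hN : HasDim P 0) (h : Nat.card {x : P // grade ℕ x = 0} ≤ 1)
    (x : P) : IsBot x := by
  have h0 : ∀ y : P, grade ℕ y = 0 := fun y => Nat.le_zero.1 (hN.2 ⟨y, rfl⟩)
  have := Finite.card_le_one_iff_subsingleton.1 h
  intro y
  exact (congrArg Subtype.val (Subsingleton.elim (⟨x, h0 x⟩ : {x : P // grade ℕ x = 0})
    ⟨y, h0 y⟩)).le

theorem card_withBot_le_one :
    Nat.card {w : WithBot P // ∃ x : P, grade ℕ x = 0 ∧ w ⋖ (x : WithBot P)} ≤ 1 := by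
  refine Finite.card_le_one_iff_subsingleton.2 ⟨?_⟩
  have hbot : ∀ w : {w : WithBot P // ∃ x : P, grade ℕ x = 0 ∧ w ⋖ (x : WithBot P)},
      (w : WithBot P) = ⊥ := by
    rintro ⟨w, x, hx, hwx⟩
    induction w with
    | bot => rfl
    | coe y =>
      have := grade_strictMono (𝕆 := ℕ) (WithBot.coe_covBy_coe.1 hwx).lt
      omega
  exact fun w z => Subtype.ext ((hbot w).trans (hbot z).symm)

end Counting

theorem theorem4 {P : Type*} [PartialOrder P] [Finite P] [GradeMinOrder ℕ P]
    (hbot : ∀ x : P, ¬ IsBot x)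
    {p : ℕ} (hp : p.Prime) (hP : IsLocallyQuillen p P)
    {N : ℕ} (hN : HasDim P N)
    (R : Type*) [CommRing R] [Nontrivial R]
    (hH : Subsingleton (ReducedHomology R P N)) :
    (nonMaximalCodimOne P N).Nonempty ∧
      freeProportion P N ≥
        ((p : ℝ) ^ (N + 1) - 2 * (p : ℝ) ^ N + 1) / ((p : ℝ) ^ (N + 1) - (p : ℝ) ^ N) ∧
      ((p : ℝ) ^ (N + 1) - 2 * (p : ℝ) ^ N + 1) / ((p : ℝ) ^ (N + 1) - (p : ℝ) ^ N) > 0 := by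
  have : Fact p.Prime := ⟨hp⟩
  obtain ⟨x₀, hx₀⟩ := hN.1
  replace hx₀ : grade ℕ x₀ = N := hx₀
  have hrank := card_mul_pow_le (R := R) hP hN hH
  -- For `N = 0` the rank inequality leaves a single object, which would be a smallest element.
  have hN0 : N ≠ 0 := by
    rintro rfl
    rw [pow_zero, mul_one] at hrank
    exact hbot x₀ (isBot_of_card_le_one hN (hrank.trans card_withBot_le_one) x₀)
  replace hrank := hrank.trans (card_withBot_le hN0)
  have hApos : 0 < Nat.card {x : P // grade ℕ x = N} :=
    have : Nonempty {x : P // grade ℕ x = N} := ⟨⟨x₀, hx₀⟩⟩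
    Nat.card_pos
  have hMpos : 0 < (nonMaximalCodimOne P N).ncard :=
    (Nat.mul_pos hApos (pow_pos hp.pos N)).trans_le hrank
  have hp1 : 0 < p - 1 := Nat.sub_pos_of_lt hp.one_lt
  have hcount := two_mul_card_le (c := (p ^ (N + 1) - 1) / (p - 1)) hN fun x hx =>
    (Nat.le_div_iff_mul_le hp1).2 (card_covBy_le hP hx)
  have hdiv : (p ^ (N + 1) - 1) / (p - 1) * (p - 1) ≤ p ^ (N + 1) - 1 := Nat.div_mul_le_self _ _
  unfold freeProportion
  set m := (nonMaximalCodimOne P N).ncard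
  set f := (freeCodimOne P N).ncard
  set A := Nat.card {x : P // grade ℕ x = N}
  set c := (p ^ (N + 1) - 1) / (p - 1)
  have hp2 : (2 : ℝ) ≤ p := by exact_mod_cast hp.two_le
  have hpN : (0 : ℝ) < (p : ℝ) ^ N := by positivity
  have hD : (0 : ℝ) < (p : ℝ) ^ (N + 1) - (p : ℝ) ^ N := by
    rw [pow_succ]; nlinarith
  have hnum : (0 : ℝ) < (p : ℝ) ^ (N + 1) - 2 * (p : ℝ) ^ N + 1 := by
    rw [pow_succ]; nlinarith
  refine ⟨Set.nonempty_of_ncard_ne_zero hMpos.ne', ?_, div_pos hnum hD⟩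
  have hm : (0 : ℝ) < m := by exact_mod_cast hMpos
  have hrank' : (A : ℝ) * (p : ℝ) ^ N ≤ m := by exact_mod_cast hrank
  have hcount' : 2 * (m : ℝ) ≤ A * c + f := by exact_mod_cast hcount
  have hdiv' : (c : ℝ) * (p - 1) ≤ (p : ℝ) ^ (N + 1) - 1 := by
    have h1 : 1 ≤ p ^ (N + 1) := Nat.one_le_pow _ _ hp.pos
    have := (Nat.cast_le (α := ℝ)).2 hdiv
    rwa [Nat.cast_mul, Nat.cast_sub hp.one_le, Nat.cast_sub h1, Nat.cast_pow, Nat.cast_one] at this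
  rw [ge_iff_le, div_le_div_iff₀ hD hm]
  -- The factor `p ^ N * (p - 1)` is the denominator of the claimed bound: `p ^ N` pairs with `A` in
  -- the rank inequality, and `p - 1` with `c` in the hyperplane count.
  have h1 : (2 * (m : ℝ) - f) * ((p : ℝ) ^ N * (p - 1)) ≤ m * ((p : ℝ) ^ (N + 1) - 1) := by
    calc (2 * (m : ℝ) - f) * ((p : ℝ) ^ N * (p - 1))
        ≤ (A * c) * ((p : ℝ) ^ N * (p - 1)) := by
          refine mul_le_mul_of_nonneg_right (by linarith) (mul_nonneg hpN.le (by linarith))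
      _ = (A * (p : ℝ) ^ N) * (c * (p - 1)) := by ring
      _ ≤ m * ((p : ℝ) ^ (N + 1) - 1) := by
          refine mul_le_mul hrank' hdiv' (mul_nonneg (Nat.cast_nonneg _) (by linarith)) hm.le
  rw [pow_succ] at h1 ⊢
  linarith
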